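/- Let $K$ be a number field with ring of integers $\mathcal O_K$, and let $V$ be the set of its places, each represented by its usual normalised absolute value $|\cdot|_v$ (so $V$ contains exactly one nontrivial absolute value from each equivalence class); let $Arch\subset V$ be the set of Archimedean places. Let $*$ be a countably saturated nonstandard embedding, ${}^*K$ the corresponding nonstandard extension of $K$, and extend each $|\cdot|_v$ to an internal absolute value ${}^*K\to{}^*\mathbb R$. Endow ${}^*K$ with the uniform structure generated by the entourages $\{(x,y) : |x-y|_v<\varepsilon\}$ for $v\in V$ and standard real $\varepsilon>0$, and with the induced topology. Put $$\mathrm{inf}_V({}^*K)=\{x\in{}^*K : |x|_v \text{ is infinitesimal for all } v\in V\},$$ and for each finite $S\subset V$ let $\mathrm{fin}_{V,S}({}^*K)$ be the subring of all $x\in{}^*K$ such that $|x|_v$ is finite (bounded by a standard real number) for all $v\in V$, and $|x|_v\le 1$ for all $v\in V\setminus(S\cup Arch)$. Let $$U_{V,S}({}^*K)=\mathrm{fin}_{V,S}({}^*K)^\times$$ be its unit group, i.e. the group of all $x\in({}^*K)^\times$ such that $x$ and $x^{-1}$ are finite at all $v\in V$ and $|x|_v=1$ for all $v\in V\setminus(S\cup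 Arch)$, with the subspace topology from ${}^*K$. Let $$U_V({}^*K)=\varinjlim_S U_{V,S}({}^*K)=\bigcup_S U_{V,S}({}^*K)$$ be the direct limit over the finite subsets $S\subset V$, ordered by inclusion, with the final topology with respect to the inclusions of the $U_{V,S}({}^*K)$. Let $(A_K)^\times$ be the idele group of $K$, i.e. the unit group of the adele ring with its usual topology. **Proposition.** $U_V({}^*K)$ is a topological group and is locally quasi-compact (each point has a neighbourhood basis of quasi-compact sets; no Hausdorff condition). The canonical map $$\varphi: U_V({}^*K)\to (A_K)^\times,$$ which sends $x$ to the family $(\alpha_v)_{v\in V}$ of its standard parts (that is, $\alpha_v\in K_v$ and $|x-\alpha_v|_v$, computed in ${}^*(K_v)$, is infinitesimal for all $v\in V$), is a well-defined, continuous and surjective group homomorphism. Its kernel is $1+\mathrm{inf}_V({}^*K)=\overline{\{1\}}$, the closure being taken in $U_V({}^*K)$. It induces an isomorphism of groups $$U_V({}^*K)/(1+\mathrm{inf}_V({}^*K))\;\cong\;(A_K)^\times$$ which is a homeomorphism for the quotient topology; in other words, the ideles are the Hausdorff topological group associated with $U_V({}^*K)$. -/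

import Mathlib

open scoped NumberField
open IsDedekindDomain

universe u w

/-- A nonstandard extension (nonstandard embedding) `*`, acting on all sets (types) `X`,
functions `f : X → Y`, points `x ∈ X` and subsets `A ⊆ X`:
`Ext X` is `*X`, `map f` is `*f`, `std x` is `*x`, and `setExt A` is `*A`.

The laws are the transfer principle, one clause for each logical construction: substitution of
functions (`setExt_preimage`), conjunction, negation, equality and existential quantification
(`setExt_inter`, `setExt_compl`, `setExt_diagonal`, `setExt_image`), with finitely many variables
(`pair_bijective`: `*(X × Y) = *X × *Y`). Relations are treated as subsets of products, and
higher order objects through the sets `Set X`, `Set (Set X)`, and so on. -/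
structure NonstandardExtension where
  Ext : Type u → Type w
  map : ∀ {X Y : Type u}, (X → Y) → Ext X → Ext Y
  std : ∀ {X : Type u}, X → Ext X
  setExt : ∀ {X : Type u}, Set X → Set (Ext X)
  map_id : ∀ {X : Type u} (x : Ext X), map (fun t : X => t) x = x
  map_comp : ∀ {X Y Z : Type u} (g : Y → Z) (f : X → Y) (x : Ext X),
    map g (map f x) = map (fun t => g (f t)) x
  map_std : ∀ {X Y : Type u} (f : X → Y) (x : X), map f (std x) = std (f x)
  pair_bijective : ∀ (X Y : Type u), Function.Bijective
    (fun z : Ext (X × Y) => (map Prod.fst z, map Prod.snd z))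
  std_mem_setExt : ∀ {X : Type u} (x : X) (A : Set X), std x ∈ setExt A ↔ x ∈ A
  setExt_compl : ∀ {X : Type u} (A : Set X), setExt Aᶜ = (setExt A)ᶜ
  setExt_inter : ∀ {X : Type u} (A B : Set X), setExt (A ∩ B) = setExt A ∩ setExt B
  setExt_preimage : ∀ {X Y : Type u} (f : X → Y) (A : Set Y),
    setExt (f ⁻¹' A) = map f ⁻¹' setExt A
  setExt_image : ∀ {X Y : Type u} (f : X → Y) (A : Set X),
    setExt (f '' A) = map f '' setExt A
  setExt_diagonal : ∀ (X : Type u),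
    setExt {p : X × X | p.1 = p.2} = {z | map Prod.fst z = map Prod.snd z}

namespace NonstandardExtension

variable (E : NonstandardExtension.{u, w})

/-- The element of `*(X × Y)` corresponding to the pair `(x, y) ∈ *X × *Y`. -/
noncomputable def pair {X Y : Type u} (x : E.Ext X) (y : E.Ext Y) : E.Ext (X × Y) :=
  (Equiv.ofBijective _ (E.pair_bijective X Y)).symm (x, y)

/-- The extension of a function of two variables. -/
noncomputable def map₂ {X Y Z : Type u} (f : X → Y → Z) (x : E.Ext X) (y : E.Ext Y) : E.Ext Z :=
  E.map (fun p : X × Y => f p.1 p.2) (E.pair x y)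

/-- The extension of a binary relation. -/
def Rel {X Y : Type u} (R : X → Y → Prop) (x : E.Ext X) (y : E.Ext Y) : Prop :=
  E.pair x y ∈ E.setExt {p : X × Y | R p.1 p.2}

/-- An internal subset of `*X` is an element `a` of `*(𝒫 X)`, identified with the set of all
`x ∈ *X` such that `x *∈ a`. -/
def IsInternal {X : Type u} (A : Set (E.Ext X)) : Prop :=
  ∃ a : E.Ext (Set X), A = {x | E.Rel (fun (t : X) (B : Set X) => t ∈ B) x a}

/-- Countable saturation: a countable family of internal sets with the finite intersection
property has nonempty intersection. -/
def CountablySaturated : Prop :=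
  ∀ (X : Type u) (A : ℕ → Set (E.Ext X)), (∀ n, E.IsInternal (A n)) →
    (∀ F : Finset ℕ, (⋂ n ∈ F, A n).Nonempty) → (⋂ n, A n).Nonempty

section basic

variable {E}

lemma map_fst_pair {X Y : Type u} (x : E.Ext X) (y : E.Ext Y) :
    E.map Prod.fst (E.pair x y) = x :=
  congrArg Prod.fst ((Equiv.ofBijective _ (E.pair_bijective X Y)).apply_symm_apply (x, y))

lemma map_snd_pair {X Y : Type u} (x : E.Ext X) (y : E.Ext Y) :
    E.map Prod.snd (E.pair x y) = y :=
  congrArg Prod.snd ((Equiv.ofBijective _ (E.pair_bijective X Y)).apply_symm_apply (x, y))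

lemma ext_pair {X Y : Type u} {z z' : E.Ext (X × Y)} (h1 : E.map Prod.fst z = E.map Prod.fst z')
    (h2 : E.map Prod.snd z = E.map Prod.snd z') : z = z' :=
  (E.pair_bijective X Y).1 (Prod.ext h1 h2)

lemma map_const {X Y : Type u} (y : Y) (x : E.Ext X) : E.map (fun _ => y) x = E.std y := by
  have hd : E.setExt (Set.univ : Set X) = Set.univ := by
    have h0 : E.setExt (∅ : Set X) = ∅ := by
      have h := E.setExt_inter (∅ : Set X) (∅ : Set X)ᶜ
      rw [E.setExt_compl] at h
      simpa using h
    have h := E.setExt_compl (∅ : Set X)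
    rwa [h0, Set.compl_empty, Set.compl_empty] at h
  have hm : E.map (fun _ => y) x ∈ E.setExt ({y} : Set Y) := by
    have h := E.setExt_preimage (fun _ : X => y) ({y} : Set Y)
    have h' : ((fun _ : X => y) ⁻¹' ({y} : Set Y)) = Set.univ := by
      ext t; simp
    rw [h', hd] at h
    have : x ∈ (Set.univ : Set (E.Ext X)) := trivial
    rw [h] at this
    exact this
  have hs : E.pair (E.map (fun _ => y) x) (E.std y) ∈ E.setExt {p : Y × Y | p.1 = p.2} := by
    have hsub : (Prod.fst ⁻¹' ({y} : Set Y)) ∩ (Prod.snd ⁻¹' ({y} : Set Y)) =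
        ((Prod.fst ⁻¹' ({y} : Set Y)) ∩ (Prod.snd ⁻¹' ({y} : Set Y))) ∩
          {p : Y × Y | p.1 = p.2} := by
      ext p
      simp only [Set.mem_inter_iff, Set.mem_preimage, Set.mem_singleton_iff, Set.mem_ofPred_eq]
      constructor
      · rintro ⟨a, b⟩; exact ⟨⟨a, b⟩, a.trans b.symm⟩
      · exact fun h => h.1
    have hmem : E.pair (E.map (fun _ => y) x) (E.std y) ∈
        E.setExt ((Prod.fst ⁻¹' ({y} : Set Y)) ∩ (Prod.snd ⁻¹' ({y} : Set Y))) := by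
      rw [E.setExt_inter, E.setExt_preimage, E.setExt_preimage]
      refine ⟨?_, ?_⟩
      · rw [Set.mem_preimage, map_fst_pair]; exact hm
      · rw [Set.mem_preimage, map_snd_pair, E.std_mem_setExt]; rfl
    rw [hsub, E.setExt_inter] at hmem
    exact hmem.2
  rw [E.setExt_diagonal] at hs
  have hs' : E.map Prod.fst (E.pair (E.map (fun _ => y) x) (E.std y)) =
      E.map Prod.snd (E.pair (E.map (fun _ => y) x) (E.std y)) := hs
  rwa [map_fst_pair, map_snd_pair] at hs'

lemma pair_map {W X Y : Type u} (f : W → X) (g : W → Y) (t : E.Ext W) :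
    E.pair (E.map f t) (E.map g t) = E.map (fun s => (f s, g s)) t := by
  apply ext_pair
  · rw [map_fst_pair, E.map_comp]
  · rw [map_snd_pair, E.map_comp]

lemma map₂_map {W X Y Z : Type u} (f : X → Y → Z) (a : W → X) (b : W → Y) (t : E.Ext W) :
    E.map₂ f (E.map a t) (E.map b t) = E.map (fun s => f (a s) (b s)) t := by
  rw [map₂, pair_map, E.map_comp]

/-- Identities in one variable transfer. -/
lemma exists_one {X : Type u} (x : E.Ext X) :
    ∃ t : E.Ext X, x = E.map (fun s => s) t := ⟨x, (E.map_id x).symm⟩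

lemma exists_two {X Y : Type u} (x : E.Ext X) (y : E.Ext Y) :
    ∃ t : E.Ext (X × Y), x = E.map (fun s => s.1) t ∧ y = E.map (fun s => s.2) t :=
  ⟨E.pair x y, (map_fst_pair x y).symm, (map_snd_pair x y).symm⟩

lemma exists_three {X Y Z : Type u} (x : E.Ext X) (y : E.Ext Y) (z : E.Ext Z) :
    ∃ t : E.Ext (X × Y × Z), x = E.map (fun s => s.1) t ∧ y = E.map (fun s => s.2.1) t ∧
      z = E.map (fun s => s.2.2) t := by
  refine ⟨E.pair x (E.pair y z), (map_fst_pair x _).symm, ?_, ?_⟩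
  · have h := E.map_comp (Prod.fst : Y × Z → Y) (Prod.snd : X × Y × Z → Y × Z)
      (E.pair x (E.pair y z))
    rw [map_snd_pair, map_fst_pair] at h
    exact h
  · have h := E.map_comp (Prod.snd : Y × Z → Z) (Prod.snd : X × Y × Z → Y × Z)
      (E.pair x (E.pair y z))
    rw [map_snd_pair, map_snd_pair] at h
    exact h

lemma setExt_mono {X : Type u} {A B : Set X} (h : A ⊆ B) : E.setExt A ⊆ E.setExt B := by
  have h' := E.setExt_inter A B
  rw [Set.inter_eq_left.2 h] at h'
  rw [h']
  exact Set.inter_subset_right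

lemma map_mem {X Y : Type u} {f : X → Y} {A : Set X} {B : Set Y} (h : ∀ x ∈ A, f x ∈ B)
    {x : E.Ext X} (hx : x ∈ E.setExt A) : E.map f x ∈ E.setExt B := by
  have h' : A ⊆ f ⁻¹' B := h
  have := setExt_mono (E := E) h' hx
  rw [E.setExt_preimage] at this
  exact this

lemma map₂_mem {X Y Z : Type u} {f : X → Y → Z} {A : Set X} {B : Set Y} {C : Set Z}
    (h : ∀ x ∈ A, ∀ y ∈ B, f x y ∈ C) {x : E.Ext X} {y : E.Ext Y}
    (hx : x ∈ E.setExt A) (hy : y ∈ E.setExt B) : E.map₂ f x y ∈ E.setExt C := by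
  refine map_mem (A := Prod.fst ⁻¹' A ∩ Prod.snd ⁻¹' B) (fun p hp => h p.1 hp.1 p.2 hp.2) ?_
  rw [E.setExt_inter, E.setExt_preimage, E.setExt_preimage]
  refine ⟨?_, ?_⟩
  · rw [Set.mem_preimage, map_fst_pair]; exact hx
  · rw [Set.mem_preimage, map_snd_pair]; exact hy

lemma rel_map_std {X Y Z : Type u} (R : Y → Z → Prop) (f : X → Y) (x : E.Ext X) (c : Z) :
    E.Rel R (E.map f x) (E.std c) ↔ x ∈ E.setExt {t | R (f t) c} := by
  rw [Rel, ← map_const c x, pair_map]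
  have h := E.setExt_preimage (fun s : X => (f s, c)) {p : Y × Z | R p.1 p.2}
  exact (Set.ext_iff.1 h x).symm

end basic

section ring

variable (R : Type u) [CommRing R]

instance : Zero (E.Ext R) := ⟨E.std 0⟩

instance : One (E.Ext R) := ⟨E.std 1⟩

noncomputable instance : Add (E.Ext R) := ⟨E.map₂ (fun x y => x + y)⟩

noncomputable instance : Mul (E.Ext R) := ⟨E.map₂ (fun x y => x * y)⟩

instance : Neg (E.Ext R) := ⟨E.map (fun x => -x)⟩

/-- The ring structure of `*R`: the operations are the extensions of those of `R`. -/
noncomputable instance instCommRing : CommRing (E.Ext R) where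
  nsmul := nsmulRec
  zsmul := zsmulRec
  add_assoc x y z := by
    obtain ⟨t, rfl, rfl, rfl⟩ := exists_three x y z
    change E.map₂ _ (E.map₂ _ _ _) _ = E.map₂ _ _ (E.map₂ _ _ _)
    simp only [map₂_map, add_assoc]
  mul_assoc x y z := by
    obtain ⟨t, rfl, rfl, rfl⟩ := exists_three x y z
    change E.map₂ _ (E.map₂ _ _ _) _ = E.map₂ _ _ (E.map₂ _ _ _)
    simp only [map₂_map, mul_assoc]
  left_distrib x y z := by
    obtain ⟨t, rfl, rfl, rfl⟩ := exists_three x y z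
    change E.map₂ _ _ (E.map₂ _ _ _) = E.map₂ _ (E.map₂ _ _ _) (E.map₂ _ _ _)
    simp only [map₂_map, mul_add]
  right_distrib x y z := by
    obtain ⟨t, rfl, rfl, rfl⟩ := exists_three x y z
    change E.map₂ _ (E.map₂ _ _ _) _ = E.map₂ _ (E.map₂ _ _ _) (E.map₂ _ _ _)
    simp only [map₂_map, add_mul]
  add_comm x y := by
    obtain ⟨t, rfl, rfl⟩ := exists_two x y
    change E.map₂ _ _ _ = E.map₂ _ _ _
    simp only [map₂_map, add_comm]
  mul_comm x y := by
    obtain ⟨t, rfl, rfl⟩ := exists_two x y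
    change E.map₂ _ _ _ = E.map₂ _ _ _
    simp only [map₂_map, mul_comm]
  zero_add x := by
    obtain ⟨t, rfl⟩ := exists_one x
    change E.map₂ _ (E.std 0) _ = _
    rw [← map_const (0 : R) t]
    simp only [map₂_map, zero_add]
  add_zero x := by
    obtain ⟨t, rfl⟩ := exists_one x
    change E.map₂ _ _ (E.std 0) = _
    rw [← map_const (0 : R) t]
    simp only [map₂_map, add_zero]
  one_mul x := by
    obtain ⟨t, rfl⟩ := exists_one x
    change E.map₂ _ (E.std 1) _ = _
    rw [← map_const (1 : R) t]
    simp only [map₂_map, one_mul]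
  mul_one x := by
    obtain ⟨t, rfl⟩ := exists_one x
    change E.map₂ _ _ (E.std 1) = _
    rw [← map_const (1 : R) t]
    simp only [map₂_map, mul_one]
  zero_mul x := by
    obtain ⟨t, rfl⟩ := exists_one x
    change E.map₂ _ (E.std 0) _ = E.std 0
    rw [← map_const (0 : R) t]
    simp only [map₂_map, zero_mul]
  mul_zero x := by
    obtain ⟨t, rfl⟩ := exists_one x
    change E.map₂ _ _ (E.std 0) = E.std 0
    rw [← map_const (0 : R) t]
    simp only [map₂_map, mul_zero]
  neg_add_cancel x := by
    obtain ⟨t, rfl⟩ := exists_one x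
    change E.map₂ _ (E.map _ _) _ = E.std 0
    rw [← map_const (0 : R) t, E.map_comp]
    simp only [map₂_map, neg_add_cancel]

end ring

/-- The hyperreal numbers `*ℝ` (with `ℝ` lifted to the universe of the standard sets). -/
abbrev Hyperreal : Type w := E.Ext (ULift.{u} ℝ)

/-- The standard real number `r`, seen in `*ℝ`. -/
def real (r : ℝ) : E.Hyperreal := E.std (ULift.up r)

/-- The extended order relations of `*ℝ`. -/
instance : LE E.Hyperreal := ⟨E.Rel (fun a b : ULift.{u} ℝ => a.down ≤ b.down)⟩

instance : LT E.Hyperreal := ⟨E.Rel (fun a b : ULift.{u} ℝ => a.down < b.down)⟩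

/-- The extension `*f : *X → *ℝ` of a real function. -/
def realMap {X : Type u} (f : X → ℝ) : E.Ext X → E.Hyperreal :=
  E.map (fun x => ULift.up (f x))

/-- A hyperreal number `a ≥ 0` is finite if it is bounded by a standard real number
(only used for nonnegative `a`). -/
def IsFin (a : E.Hyperreal) : Prop := ∃ r : ℝ, a ≤ E.real r

/-- A hyperreal number `a ≥ 0` is infinitesimal if it is smaller than every standard positive
real number (only used for nonnegative `a`). -/
def IsInf (a : E.Hyperreal) : Prop := ∀ ε : ℝ, 0 < ε → a < E.real ε

section basic

variable {E}

lemma realMap_le {X : Type u} (f : X → ℝ) (x : E.Ext X) (r : ℝ) :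
    E.realMap f x ≤ E.real r ↔ x ∈ E.setExt {t | f t ≤ r} :=
  rel_map_std (fun a b : ULift.{u} ℝ => a.down ≤ b.down) (fun t => ULift.up (f t)) x (ULift.up r)

lemma realMap_lt {X : Type u} (f : X → ℝ) (x : E.Ext X) (r : ℝ) :
    E.realMap f x < E.real r ↔ x ∈ E.setExt {t | f t < r} :=
  rel_map_std (fun a b : ULift.{u} ℝ => a.down < b.down) (fun t => ULift.up (f t)) x (ULift.up r)

end basic

end NonstandardExtension

/-- The set `V` of all places of the number field `K`: the Archimedean ones and
the non-Archimedean ones. -/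
abbrev NFPlace (K : Type u) [Field K] [NumberField K] : Type u :=
  NumberField.InfinitePlace K ⊕ HeightOneSpectrum (𝓞 K)

/-- The normalised absolute value of a place: `|σ(x)|` for an embedding `σ : K → ℂ`, and
`N(𝔭) ^ (-ord_𝔭 x)` for a maximal ideal `𝔭`. -/
noncomputable def NFPlace.abs {K : Type u} [Field K] [NumberField K] :
    NFPlace K → AbsoluteValue K ℝ
  | .inl v => v.1
  | .inr p => NumberField.HeightOneSpectrum.adicAbv K p

namespace NonstandardExtension

variable (E : NonstandardExtension.{u, w}) (K : Type u) [Field K] [NumberField K]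

/-- The internal absolute value `|·|_v : *K → *ℝ` of a standard place `v`. -/
noncomputable def absV {K : Type u} [Field K] [NumberField K] (v : NFPlace K) :
    E.Ext K → E.Hyperreal :=
  E.realMap (fun x => NFPlace.abs v x)

/-- The uniform structure of `*K`, generated by the entourages
`{(x, y) | |x - y|_v < ε}` for `v ∈ V` and standard `ε > 0`. -/
@[reducible] noncomputable def uniformSpaceV : UniformSpace (E.Ext K) :=
  UniformSpace.ofCore
    { uniformity := ⨅ (v : NFPlace K) (ε : {ε : ℝ // 0 < ε}),
        Filter.principal {p : E.Ext K × E.Ext K | E.absV v (p.1 - p.2) < E.real ε.1}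
      refl := by
        refine le_iInf fun v => le_iInf fun ε => Filter.principal_mono.2 ?_
        rintro ⟨x, y⟩ (rfl : x = y)
        change E.absV v (x - x) < E.real ε.1
        rw [sub_self, absV, realMap_lt]
        refine (E.std_mem_setExt (0 : K) _).2 ?_
        simpa using ε.2
      symm := by
        refine Filter.tendsto_iInf.2 fun v => Filter.tendsto_iInf.2 fun ε =>
          Filter.tendsto_principal.2 ?_
        refine Filter.mem_iInf_of_mem v (Filter.mem_iInf_of_mem ε
          (Filter.mem_principal.2 fun p hp => ?_))
        change E.absV v (p.2 - p.1) < E.real ε.1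
        have hp' : E.absV v (p.1 - p.2) < E.real ε.1 := hp
        rw [absV, realMap_lt] at hp' ⊢
        rw [← neg_sub]
        refine map_mem (f := fun t : K => -t) (fun t ht => ?_) hp'
        simpa using ht
      comp := by
        refine le_iInf fun v => le_iInf fun ε => ?_
        have hmem : {p : E.Ext K × E.Ext K | E.absV v (p.1 - p.2) < E.real (ε.1 / 2)} ∈
            ⨅ (v : NFPlace K) (ε : {ε : ℝ // 0 < ε}),
              Filter.principal {p : E.Ext K × E.Ext K | E.absV v (p.1 - p.2) < E.real ε.1} :=
          Filter.mem_iInf_of_mem v (Filter.mem_iInf_of_mem ⟨ε.1 / 2, half_pos ε.2⟩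
            (Filter.mem_principal.2 (le_refl _)))
        refine (Filter.lift'_le hmem le_rfl).trans (Filter.principal_mono.2 ?_)
        rintro ⟨x, y⟩ ⟨z, h1, h2⟩
        have h1' : E.absV v (x - z) < E.real (ε.1 / 2) := h1
        have h2' : E.absV v (z - y) < E.real (ε.1 / 2) := h2
        change E.absV v (x - y) < E.real ε.1
        rw [absV, realMap_lt] at h1' h2' ⊢
        rw [← sub_add_sub_cancel x z y]
        refine map₂_mem (f := fun a b : K => a + b) (fun a ha b hb => ?_) h1' h2'
        have ha' : NFPlace.abs v a < ε.1 / 2 := ha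
        have hb' : NFPlace.abs v b < ε.1 / 2 := hb
        have := (NFPlace.abs v).add_le a b
        change NFPlace.abs v (a + b) < ε.1
        linarith }

/-- `fin_{V,S}(*K)`: the subring of all `x ∈ *K` which are finite at all places `v ∈ V` and satisfy
`|x|_v ≤ 1` for all non-Archimedean `v ∉ S`. -/
noncomputable def finVS (S : Finset (NFPlace K)) : Subring (E.Ext K) where
  carrier := {x | (∀ v : NFPlace K, E.IsFin (E.absV v x)) ∧
    ∀ p : HeightOneSpectrum (𝓞 K), Sum.inr p ∉ S → E.absV (Sum.inr p) x ≤ E.real 1}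
  zero_mem' := by
    refine ⟨fun v => ⟨0, ?_⟩, fun p _ => ?_⟩
    · rw [absV, realMap_le]
      exact (E.std_mem_setExt (0 : K) _).2 (by simp)
    · rw [absV, realMap_le]
      exact (E.std_mem_setExt (0 : K) _).2 (by simp)
  one_mem' := by
    refine ⟨fun v => ⟨1, ?_⟩, fun p _ => ?_⟩
    · rw [absV, realMap_le]
      exact (E.std_mem_setExt (1 : K) _).2 (by simp)
    · rw [absV, realMap_le]
      exact (E.std_mem_setExt (1 : K) _).2 (by simp)
  add_mem' := by
    rintro x y ⟨hx, hx'⟩ ⟨hy, hy'⟩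
    refine ⟨fun v => ?_, fun p hp => ?_⟩
    · obtain ⟨r, hr⟩ := hx v
      obtain ⟨s, hs⟩ := hy v
      refine ⟨r + s, ?_⟩
      rw [absV, realMap_le] at hr hs ⊢
      refine map₂_mem (f := fun a b : K => a + b) (fun a ha b hb => ?_) hr hs
      exact ((NFPlace.abs v).add_le a b).trans (add_le_add ha hb)
    · have h1 := hx' p hp
      have h2 := hy' p hp
      rw [absV, realMap_le] at h1 h2 ⊢
      refine map₂_mem (f := fun a b : K => a + b) (fun a ha b hb => ?_) h1 h2
      exact (NumberField.HeightOneSpectrum.adicAbv_add_le_max K p a b).trans (max_le ha hb)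
  mul_mem' := by
    rintro x y ⟨hx, hx'⟩ ⟨hy, hy'⟩
    refine ⟨fun v => ?_, fun p hp => ?_⟩
    · obtain ⟨r, hr⟩ := hx v
      obtain ⟨s, hs⟩ := hy v
      refine ⟨r * s, ?_⟩
      rw [absV, realMap_le] at hr hs ⊢
      refine map₂_mem (f := fun a b : K => a * b) (fun a ha b hb => ?_) hr hs
      have ha' : NFPlace.abs v a ≤ r := ha
      change NFPlace.abs v (a * b) ≤ r * s
      rw [map_mul]
      exact mul_le_mul ha' hb ((NFPlace.abs v).nonneg b) (((NFPlace.abs v).nonneg a).trans ha')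
    · have h1 := hx' p hp
      have h2 := hy' p hp
      rw [absV, realMap_le] at h1 h2 ⊢
      refine map₂_mem (f := fun a b : K => a * b) (fun a ha b hb => ?_) h1 h2
      change NFPlace.abs (Sum.inr p) (a * b) ≤ 1
      rw [map_mul]
      exact mul_le_one₀ ha ((NFPlace.abs (Sum.inr p)).nonneg b) hb
  neg_mem' := by
    rintro x ⟨hx, hx'⟩
    refine ⟨fun v => ?_, fun p hp => ?_⟩
    · obtain ⟨r, hr⟩ := hx v
      refine ⟨r, ?_⟩
      rw [absV, realMap_le] at hr ⊢
      refine map_mem (f := fun a : K => -a) (fun a ha => ?_) hr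
      simpa using ha
    · have h1 := hx' p hp
      rw [absV, realMap_le] at h1 ⊢
      refine map_mem (f := fun a : K => -a) (fun a ha => ?_) h1
      simpa using ha

/-- `U_{V,S}(*K) = fin_{V,S}(*K)ˣ`, as a subgroup of `(*K)ˣ`: the units `x` of `*K` such that
`x` and `x⁻¹` belong to `fin_{V,S}(*K)`. -/
noncomputable def unitsVS (S : Finset (NFPlace K)) : Subgroup (E.Ext K)ˣ :=
  (E.finVS K S).toSubmonoid.units

lemma unitsVS_mono {S T : Finset (NFPlace K)} (h : S ⊆ T) : E.unitsVS K S ≤ E.unitsVS K T := by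
  have h' : (E.finVS K S).toSubmonoid ≤ (E.finVS K T).toSubmonoid :=
    fun x hx => ⟨hx.1, fun p hp => hx.2 p fun hS => hp (h hS)⟩
  exact Submonoid.units_mono h'

open scoped Classical in
/-- The underlying group of `U_V(*K)`: the directed union of the groups `U_{V,S}(*K)` over all
finite sets `S` of places. -/
noncomputable def unitsVSubgroup : Subgroup (E.Ext K)ˣ where
  carrier := ⋃ S : Finset (NFPlace K), (E.unitsVS K S : Set (E.Ext K)ˣ)
  one_mem' := Set.mem_iUnion.2 ⟨∅, one_mem _⟩
  mul_mem' := by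
    intro x y hx hy
    obtain ⟨S, hS⟩ := Set.mem_iUnion.1 hx
    obtain ⟨T, hT⟩ := Set.mem_iUnion.1 hy
    exact Set.mem_iUnion.2 ⟨S ∪ T, mul_mem (E.unitsVS_mono K Finset.subset_union_left hS)
      (E.unitsVS_mono K Finset.subset_union_right hT)⟩
  inv_mem' := by
    intro x hx
    obtain ⟨S, hS⟩ := Set.mem_iUnion.1 hx
    exact Set.mem_iUnion.2 ⟨S, inv_mem hS⟩

/-- The group `U_V(*K)`, the direct limit of the groups `U_{V,S}(*K)`. -/
def UnitsV : Type w := E.unitsVSubgroup K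

noncomputable instance : CommGroup (E.UnitsV K) :=
  inferInstanceAs (CommGroup (E.unitsVSubgroup K))

variable {E K} in
/-- The inclusion of `U_V(*K)` in `*K`. -/
def UnitsV.val (x : E.UnitsV K) : E.Ext K := ((x.1 : (E.Ext K)ˣ) : E.Ext K)

/-- The inclusion of `U_{V,S}(*K)` in `U_V(*K)`. -/
def unitsVSIncl (S : Finset (NFPlace K)) (x : E.unitsVS K S) : E.UnitsV K :=
  ⟨x.1, Set.mem_iUnion.2 ⟨S, x.2⟩⟩

/-- The topology of `U_{V,S}(*K)` as a subspace of `*K`. -/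
@[reducible] noncomputable def unitsVSTopology (S : Finset (NFPlace K)) : TopologicalSpace (E.unitsVS K S) :=
  (E.uniformSpaceV K).toTopologicalSpace.induced
    (fun x => ((x.1 : (E.Ext K)ˣ) : E.Ext K))

/-- The final topology of `U_V(*K)` with respect to the inclusions of the `U_{V,S}(*K)`. -/
noncomputable instance : TopologicalSpace (E.UnitsV K) :=
  ⨆ S : Finset (NFPlace K), (E.unitsVSTopology K S).coinduced (E.unitsVSIncl K S)

/-- `inf_V(*K)`: the elements of `*K` which are infinitesimal at all places. -/
def infV : Set (E.Ext K) := {x | ∀ v : NFPlace K, E.IsInf (E.absV v x)}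

/-- `α ∈ 𝔸_K` is the family of the standard parts of `x ∈ *K`: for every place `v`, the hyperreal
number `|x - α_v|_v`, computed in `*(K_v)`, is infinitesimal. (It is the value at `x` of the
extension of the function `K → ℝ`, `y ↦ |y - α_v|_v`.) -/
def IsStandardPart {K : Type u} [Field K] [NumberField K] (x : E.Ext K)
    (α : NumberField.AdeleRing (𝓞 K) K) : Prop :=
  (∀ v : NumberField.InfinitePlace K,
    E.IsInf (E.realMap (fun y : K => ‖(y : v.Completion) - α.1 v‖) x)) ∧
  (∀ p : HeightOneSpectrum (𝓞 K),
    E.IsInf (E.realMap (fun y : K => ‖algebraMap K (p.adicCompletion K) y - α.2 p‖) x))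

end NonstandardExtension

/-! A point `x` of `*X` determines the ultrafilter `type x` of all `A ⊆ X` with `x ∈ *A`. Being
infinitely close to `α_v` at `v` means that `K → K_v` converges to `α_v` along `type x`. Standard
parts are thus ultrafilter limits: they are unique because `K_v` is Hausdorff, exist at finite
points because `K_v` is proper, and respect the ring operations by continuity. For `x` in
`fin_{V,S}` the limits are integral outside `S`, so they form an adele.

Surjectivity is weak approximation at finitely many places, combined with countable saturation, as
`K` has countably many places (`CountablySaturated.exists_isStandardPart`).

The heart is `isInducing_standardPart`: the final topology on `U_V(*K)` is the pullback of the idele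
topology. On `U_{V,S}` the subspace topology is the topology of convergence at each place, and on
ideles integral outside `S` together with their inverses this is the idele topology. Moreover
`U_{V,S}` is exactly the preimage of the open set `idelesS S`, since the local integer rings are
both open and closed. Everything else is formal: a surjective inducing homomorphism onto a locally
compact Hausdorff group transfers the group topology and local compactness, has kernel the closure
of the identity, and descends to a homeomorphism. -/

open Topology Filter

/-! ### Local compactness of completions, adeles and ideles; countability of the set of places. -/

namespace NumberField
section norm

variable {K : Type u} [Field K] [NumberField K]

lemma norm_adicCompletion_le_one_iff {p : HeightOneSpectrum (𝓞 K)} {x : p.adicCompletion K} :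
    ‖x‖ ≤ 1 ↔ x ∈ p.adicCompletionIntegers K :=
  Valued.toNormedField.norm_le_one_iff

lemma norm_adicCompletion_lt_one_iff {p : HeightOneSpectrum (𝓞 K)} {x : p.adicCompletion K} :
    ‖x‖ < 1 ↔ Valued.v x < 1 :=
  Valued.toNormedField.norm_lt_one_iff

end norm

variable (K : Type u) [Field K] [NumberField K]

/-- The finite ring `𝓞 K ⧸ p` surjects onto the residue field: an integral `x` is congruent to some
`k ∈ K` by density, and `k`, being integral at `p`, is congruent to an algebraic integer. -/
instance finite_residueField_adicCompletionIntegers (p : HeightOneSpectrum (𝓞 K)) :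
    Finite (IsLocalRing.ResidueField (p.adicCompletionIntegers K)) := by
  have : Finite (𝓞 K ⧸ p.asIdeal) := p.asIdeal.finiteQuotientOfFreeOfNeBot p.ne_bot
  let f : 𝓞 K →+* IsLocalRing.ResidueField (p.adicCompletionIntegers K) :=
    (IsLocalRing.residue _).comp (algebraMap (𝓞 K) (p.adicCompletionIntegers K))
  have key : ∀ x : p.adicCompletionIntegers K, Valued.v (x : p.adicCompletion K) < 1 →
      IsLocalRing.residue _ x = 0 := by
    intro x hx
    rw [IsLocalRing.residue_eq_zero_iff, IsLocalRing.mem_maximalIdeal, mem_nonunits_iff,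
      HeightOneSpectrum.adicCompletionIntegers.isUnit_iff_valued_eq_one]
    exact hx.ne
  have hf : ∀ a ∈ p.asIdeal, f a = 0 := by
    intro a ha
    refine key _ ?_
    refine (HeightOneSpectrum.valuedAdicCompletion_eq_valuation' p _).trans_lt ?_
    exact (p.valuation_lt_one_iff_mem a).2 ha
  refine Finite.of_surjective (Ideal.Quotient.lift p.asIdeal f hf) fun y => ?_
  obtain ⟨⟨x, hx⟩, rfl⟩ := IsLocalRing.residue_surjective y
  obtain ⟨k, hk⟩ := (HeightOneSpectrum.denseRange_algebraMap K p).exists_dist_lt x one_pos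
  rw [dist_eq_norm, norm_adicCompletion_lt_one_iff] at hk
  have hk1 : p.valuation K k ≤ 1 := by
    rw [← HeightOneSpectrum.valuedAdicCompletion_eq_valuation' p k]
    have := Valued.v.map_sub x (x - algebraMap K (p.adicCompletion K) k)
    rw [sub_sub_cancel] at this
    exact this.trans (max_le hx hk.le)
  obtain ⟨a, ha⟩ := p.exists_valuation_sub_lt_of_integer hk1 1
  refine ⟨Ideal.Quotient.mk _ a, ?_⟩
  rw [Ideal.Quotient.lift_mk]
  change IsLocalRing.residue _ _ = _
  rw [← sub_eq_zero, ← map_sub]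
  refine key _ ?_
  have ha' : Valued.v (algebraMap K (p.adicCompletion K) (algebraMap (𝓞 K) K a - k)) < 1 := by
    refine (HeightOneSpectrum.valuedAdicCompletion_eq_valuation' p _).trans_lt ?_
    simpa using ha
  rw [← Valuation.map_neg] at hk
  have h := Valued.v.map_add_lt ha' hk
  rw [map_sub, neg_sub, sub_add_sub_cancel] at h
  exact h

instance properSpace_adicCompletion (p : HeightOneSpectrum (𝓞 K)) :
    ProperSpace (p.adicCompletion K) :=
  have h1 : IsDiscreteValuationRing (p.adicCompletionIntegers K) := inferInstance
  Valued.integer.properSpace_iff_completeSpace_and_isDiscreteValuationRing_integer_and_finite_residueField.2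
    ⟨inferInstance, h1, finite_residueField_adicCompletionIntegers K p⟩

instance compactSpace_adicCompletionIntegers (p : HeightOneSpectrum (𝓞 K)) :
    CompactSpace (p.adicCompletionIntegers K) :=
  Valued.integer.properSpace_iff_compactSpace_integer.1 (properSpace_adicCompletion K p)

/-- The isometric embedding into `ℂ` is closed, so closed balls are preimages of compact balls. -/
instance properSpace_completion (v : InfinitePlace K) : ProperSpace v.Completion :=
  have h : Isometry (InfinitePlace.Completion.extensionEmbedding v) :=
    InfinitePlace.Completion.isometry_extensionEmbedding v
  ⟨fun x r => by
    rw [← h.preimage_closedBall]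
    exact h.isClosedEmbedding.isCompact_preimage (isCompact_closedBall _ _)⟩

instance : LocallyCompactSpace (FiniteAdeleRing (𝓞 K) K) :=
  haveI : Fact (∀ p : HeightOneSpectrum (𝓞 K),
      IsOpen (p.adicCompletionIntegers K : Set (p.adicCompletion K))) :=
    ⟨fun _ ↦ Valued.isOpen_valuationSubring _⟩
  inferInstanceAs (LocallyCompactSpace (RestrictedProduct
    (fun p : HeightOneSpectrum (𝓞 K) => p.adicCompletion K)
    (fun p => (p.adicCompletionIntegers K : Set (p.adicCompletion K))) cofinite))

instance : T2Space (FiniteAdeleRing (𝓞 K) K) :=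
  inferInstanceAs (T2Space (RestrictedProduct
    (fun p : HeightOneSpectrum (𝓞 K) => p.adicCompletion K)
    (fun p => (p.adicCompletionIntegers K : Set (p.adicCompletion K))) cofinite))

instance : T2Space (InfiniteAdeleRing K) :=
  inferInstanceAs (T2Space ((v : InfinitePlace K) → v.Completion))

instance : LocallyCompactSpace (AdeleRing (𝓞 K) K) :=
  inferInstanceAs (LocallyCompactSpace (InfiniteAdeleRing K × FiniteAdeleRing (𝓞 K) K))

instance : T2Space (AdeleRing (𝓞 K) K) :=
  inferInstanceAs (T2Space (InfiniteAdeleRing K × FiniteAdeleRing (𝓞 K) K))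

/-- `u ↦ (u, u⁻¹)` embeds the ideles as a closed subset of a product of two locally compact spaces.
-/
instance : LocallyCompactSpace (AdeleRing (𝓞 K) K)ˣ :=
  Units.isClosedEmbedding_embedProduct.locallyCompactSpace

/-- Countability lets countable saturation treat all places at once. A prime ideal is determined by
a finite generating set in the countable ring `𝓞 K`. -/
lemma countable_nfPlace : Countable (NFPlace K) := by
  have h1 : Countable K := (Module.finBasis ℚ K).equivFun.injective.countable
  have h2 : Countable (𝓞 K) := RingOfIntegers.coe_injective.countable
  have h3 : Countable (HeightOneSpectrum (𝓞 K)) := by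
    choose s hs using fun p : HeightOneSpectrum (𝓞 K) => IsNoetherian.noetherian p.asIdeal
    refine Function.Injective.countable (f := s) fun p q h => ?_
    apply HeightOneSpectrum.ext
    rw [← hs p, ← hs q, h]
  exact inferInstance

end NumberField

/-! ### Inequivalence of the places and weak approximation. -/

namespace NFPlace
variable {K : Type u} [Field K] [NumberField K]

lemma abs_inr_coe_le_one (p : HeightOneSpectrum (𝓞 K)) (a : 𝓞 K) :
    NFPlace.abs (.inr p) (a : K) ≤ 1 :=
  p.adicAbv_coe_le_one (NumberField.HeightOneSpectrum.one_lt_absNorm_nnreal p) a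

lemma abs_inr_coe_lt_one_iff (p : HeightOneSpectrum (𝓞 K)) (a : 𝓞 K) :
    NFPlace.abs (.inr p) (a : K) < 1 ↔ a ∈ p.asIdeal :=
  p.adicAbv_coe_lt_one_iff (NumberField.HeightOneSpectrum.one_lt_absNorm_nnreal p) a

lemma abs_isNontrivial (v : NFPlace K) : (NFPlace.abs v).IsNontrivial := by
  rcases v with v | p
  · exact v.isNontrivial
  · obtain ⟨a, ha, h0⟩ := Submodule.exists_mem_ne_zero_of_ne_bot p.ne_bot
    refine ⟨a, by simpa using h0, ?_⟩
    exact ((abs_inr_coe_lt_one_iff p a).2 ha).ne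

/-- The element `2` separates them: its absolute value is `2` at `v` and at most `1` at `p`. -/
lemma not_isEquiv_inl_inr (v : NumberField.InfinitePlace K) (p : HeightOneSpectrum (𝓞 K)) :
    ¬ (NFPlace.abs (.inl v)).IsEquiv (NFPlace.abs (.inr p)) := by
  intro h
  have h1 := (h.le_one_iff (x := ((2 : 𝓞 K) : K))).2 (abs_inr_coe_le_one p 2)
  have h2 : NFPlace.abs (.inl v) ((2 : 𝓞 K) : K) = 2 := by
    have h3 : ((2 : 𝓞 K) : K) = ((2 : ℕ) : K) := map_ofNat (algebraMap (𝓞 K) K) 2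
    rw [h3]
    exact v.map_natCast 2
  linarith

lemma abs_pairwise_not_isEquiv :
    Pairwise fun v w : NFPlace K => ¬ (NFPlace.abs v).IsEquiv (NFPlace.abs w) := by
  rintro (v | p) (w | q) hne h
  · exact hne (congrArg Sum.inl (NumberField.InfinitePlace.eq_iff_isEquiv.2 h))
  · exact not_isEquiv_inl_inr v q h
  · exact not_isEquiv_inl_inr w p h.symm
  -- The prime is recovered from its absolute value as the set of algebraic integers of absolute
  -- value less than `1`.
  · refine hne (congrArg Sum.inr (HeightOneSpectrum.ext (Ideal.ext fun a => ?_)))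
    rw [← abs_inr_coe_lt_one_iff, ← abs_inr_coe_lt_one_iff]
    exact h.lt_one_iff

/-- Weak approximation for a finite set of places. -/
lemma exists_abs_sub_lt (T : Finset (NFPlace K)) (β : NFPlace K → K) {ε : ℝ} (hε : 0 < ε) :
    ∃ t : K, ∀ v ∈ T, NFPlace.abs v (t - β v) < ε := by
  have h := AbsoluteValue.denseRange_algebraMap_pi (v := fun v : T => NFPlace.abs v.1)
    (fun v => abs_isNontrivial v.1)
    (fun v w hvw => abs_pairwise_not_isEquiv fun h => hvw (Subtype.ext h))
  obtain ⟨t, ht⟩ := h.exists_dist_lt (fun v => WithAbs.toAbs _ (β v.1)) hε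
  refine ⟨t, fun v hv => ?_⟩
  have := (dist_pi_lt_iff hε).1 ht ⟨v, hv⟩
  rw [dist_comm, dist_eq_norm, WithAbs.norm_eq_apply_ofAbs] at this
  exact this

end NFPlace

/-! ### Points of `*X` as ultrafilters, and limits along them. -/

namespace NonstandardExtension

variable {E : NonstandardExtension.{u, w}}

lemma setExt_univ (X : Type u) : E.setExt (Set.univ : Set X) = Set.univ := by
  refine Set.eq_univ_of_forall fun x => ?_
  by_contra hx
  have h : x ∈ E.setExt (Set.univ : Set X)ᶜ := by
    rw [E.setExt_compl]
    exact hx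
  exact hx (setExt_mono (Set.subset_univ _) h)

/-- The type of a point `x ∈ *X`: the ultrafilter of all sets `A ⊆ X` such that `x ∈ *A`. -/
noncomputable def type {X : Type u} (x : E.Ext X) : Ultrafilter X :=
  Ultrafilter.ofComplNotMemIff
    { sets := {A | x ∈ E.setExt A}
      univ_sets := by
        change x ∈ E.setExt Set.univ
        rw [setExt_univ]
        trivial
      sets_of_superset := fun h hAB => setExt_mono hAB h
      inter_sets := fun {A B} hA hB => by
        change x ∈ E.setExt (A ∩ B)
        rw [E.setExt_inter]
        exact ⟨hA, hB⟩ }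
    fun A => by
      change ¬ x ∈ E.setExt Aᶜ ↔ x ∈ E.setExt A
      rw [E.setExt_compl, Set.mem_compl_iff, not_not]

lemma mem_type {X : Type u} {x : E.Ext X} {A : Set X} : A ∈ type x ↔ x ∈ E.setExt A := Iff.rfl

lemma eventually_type {X : Type u} {x : E.Ext X} {p : X → Prop} :
    (∀ᶠ t in (type x : Filter X), p t) ↔ x ∈ E.setExt {t | p t} := Iff.rfl

lemma type_map {X Y : Type u} (f : X → Y) (x : E.Ext X) : type (E.map f x) = (type x).map f := by
  refine Ultrafilter.ext fun A => ?_
  rw [Ultrafilter.mem_map, mem_type, mem_type, E.setExt_preimage]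
  rfl

lemma tendsto_type_map {X Y : Type u} {Z : Type*} {f : X → Y} {x : E.Ext X} {g : Y → Z}
    {l : Filter Z} :
    Tendsto g (type (E.map f x)) l ↔ Tendsto (fun t => g (f t)) (type x) l := by
  rw [type_map, Ultrafilter.coe_map, tendsto_map'_iff]
  rfl

lemma tendsto_type_std {X : Type u} {Z : Type*} [TopologicalSpace Z] (g : X → Z) (x : X) :
    Tendsto g (type (E.std x)) (𝓝 (g x)) := by
  refine tendsto_nhds.2 fun s _ hs => ?_
  exact (E.std_mem_setExt x _).2 hs

/-- By the diagonal law, `*f` at `x` depends only on the germ of `f` along `type x`. -/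
lemma eq_of_eventually_eq {X Y : Type u} {f g : X → Y} {x : E.Ext X}
    (h : ∀ᶠ t in (type x : Filter X), f t = g t) : E.map f x = E.map g x := by
  have h1 : E.map (fun t => (f t, g t)) x ∈ E.setExt {p : Y × Y | p.1 = p.2} := by
    have := E.setExt_preimage (fun t => (f t, g t)) {p : Y × Y | p.1 = p.2}
    exact (Set.ext_iff.1 this x).1 h
  rw [E.setExt_diagonal] at h1
  have h2 : E.map Prod.fst (E.map (fun t => (f t, g t)) x) =
    E.map Prod.snd (E.map (fun t => (f t, g t)) x) := h1
  rwa [E.map_comp, E.map_comp] at h2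

lemma isInternal_setExt {X : Type u} (A : Set X) : E.IsInternal (E.setExt A) := by
  refine ⟨E.std A, Set.ext fun x => ?_⟩
  have h := rel_map_std (E := E) (fun (t : X) (B : Set X) => t ∈ B) (fun t : X => t) x A
  rw [E.map_id] at h
  exact h.symm

/-- Countable saturation for a countable family of standard sets. -/
lemma CountablySaturated.exists_mem (hE : E.CountablySaturated) {X : Type u} {ι : Type*}
    [Countable ι] (A : ι → Set X) (hA : ∀ F : Finset ι, ∃ t, ∀ i ∈ F, t ∈ A i) :
    ∃ x : E.Ext X, ∀ i, x ∈ E.setExt (A i) := by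
  classical
  rcases isEmpty_or_nonempty ι with h | h
  · obtain ⟨t, -⟩ := hA ∅
    exact ⟨E.std t, fun i => h.elim i⟩
  obtain ⟨e, he⟩ := exists_surjective_nat ι
  obtain ⟨x, hx⟩ := hE X (fun n => E.setExt (A (e n))) (fun n => isInternal_setExt _) fun F => by
    -- A standard point already witnesses each finite intersection.
    obtain ⟨t, ht⟩ := hA (F.image e)
    refine ⟨E.std t, Set.mem_iInter₂.2 fun n hn => ?_⟩
    exact (E.std_mem_setExt t _).2 (ht _ (Finset.mem_image_of_mem e hn))
  refine ⟨x, fun i => ?_⟩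
  obtain ⟨n, rfl⟩ := he i
  exact Set.mem_iInter.1 hx n

lemma realMap_le_iff {X : Type u} {f : X → ℝ} {x : E.Ext X} {r : ℝ} :
    E.realMap f x ≤ E.real r ↔ ∀ᶠ t in (type x : Filter X), f t ≤ r := realMap_le f x r

lemma realMap_lt_iff {X : Type u} {f : X → ℝ} {x : E.Ext X} {r : ℝ} :
    E.realMap f x < E.real r ↔ ∀ᶠ t in (type x : Filter X), f t < r := realMap_lt f x r

/-- This is the dictionary between infinitesimals and limits on which all later arguments rest. -/
lemma isInf_realMap_norm_sub_iff {X : Type u} {F : Type*} [SeminormedAddCommGroup F]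
    {f : X → F} {a : F} {x : E.Ext X} :
    E.IsInf (E.realMap (fun t => ‖f t - a‖) x) ↔ Tendsto f (type x) (𝓝 a) := by
  simp only [IsInf, realMap_lt_iff, Metric.tendsto_nhds, dist_eq_norm, gt_iff_lt]

section ring

variable {R : Type u} [CommRing R] {F : Type*} [NormedRing F]

/-- The separate types of `x` and `y` do not determine that of `x * y`, so both are written as
coordinates of one point `t` of `*(R × R)` and the limits are taken along `type t`. -/
lemma tendsto_type_mul (f : R →+* F) {x y : E.Ext R} {a b : F}
    (hx : Tendsto f (type x) (𝓝 a)) (hy : Tendsto f (type y) (𝓝 b)) :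
    Tendsto f (type (x * y)) (𝓝 (a * b)) := by
  obtain ⟨t, rfl, rfl⟩ := exists_two x y
  have h : E.map (fun s : R × R => s.1) t * E.map (fun s => s.2) t =
    E.map (fun s => s.1 * s.2) t := map₂_map _ _ _ _
  rw [h]
  rw [tendsto_type_map] at hx hy ⊢
  simpa only [map_mul] using hx.mul hy

lemma tendsto_type_add (f : R →+* F) {x y : E.Ext R} {a b : F}
    (hx : Tendsto f (type x) (𝓝 a)) (hy : Tendsto f (type y) (𝓝 b)) :
    Tendsto f (type (x + y)) (𝓝 (a + b)) := by
  obtain ⟨t, rfl, rfl⟩ := exists_two x y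
  have h : E.map (fun s : R × R => s.1) t + E.map (fun s => s.2) t =
    E.map (fun s => s.1 + s.2) t := map₂_map _ _ _ _
  rw [h]
  rw [tendsto_type_map] at hx hy ⊢
  simpa only [map_add] using hx.add hy

lemma tendsto_type_neg (f : R →+* F) {x : E.Ext R} {a : F}
    (hx : Tendsto f (type x) (𝓝 a)) : Tendsto f (type (-x)) (𝓝 (-a)) := by
  change Tendsto f (type (E.map (fun t => -t) x)) _
  rw [tendsto_type_map]
  simpa only [map_neg] using hx.neg

lemma tendsto_type_sub (f : R →+* F) {x y : E.Ext R} {a b : F}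
    (hx : Tendsto f (type x) (𝓝 a)) (hy : Tendsto f (type y) (𝓝 b)) :
    Tendsto f (type (x - y)) (𝓝 (a - b)) := by
  rw [sub_eq_add_neg, sub_eq_add_neg]
  exact tendsto_type_add f hx (tendsto_type_neg f hy)

lemma tendsto_type_one (f : R →+* F) : Tendsto f (type (1 : E.Ext R)) (𝓝 1) := by
  have := tendsto_type_std (E := E) f 1
  rwa [map_one] at this

end ring

/-- Inversion in `*K`. -/
lemma mul_map_inv_cancel {K : Type u} [Field K] {x : E.Ext K}
    (hx : ∀ᶠ t in (type x : Filter K), t ≠ 0) : x * E.map (fun t => t⁻¹) x = 1 := by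
  have h : E.map (fun t : K => t) x * E.map (fun t => t⁻¹) x = E.map (fun t => t * t⁻¹) x :=
    map₂_map _ _ _ _
  rw [E.map_id] at h
  rw [h, eq_of_eventually_eq (g := fun _ => (1 : K)) (hx.mono fun t ht => mul_inv_cancel₀ ht),
    map_const]
  rfl

/-- Bounded points of `*X` have a limit in a proper space. -/
lemma exists_tendsto_type {X : Type u} {F : Type*} [SeminormedAddCommGroup F] [ProperSpace F]
    {f : X → F} {x : E.Ext X} {r : ℝ} (h : ∀ᶠ t in (type x : Filter X), ‖f t‖ ≤ r) :
    ∃ a, ‖a‖ ≤ r ∧ Tendsto f (type x) (𝓝 a) := by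
  obtain ⟨a, ha, h'⟩ := (isCompact_closedBall (0 : F) r).ultrafilter_le_nhds ((type x).map f)
    (le_principal_iff.2 (h.mono fun t ht => by simpa using ht))
  exact ⟨a, by simpa using ha, h'⟩

end NonstandardExtension

namespace NFPlace

variable {K : Type u} [Field K] [NumberField K]

lemma norm_completion (v : NumberField.InfinitePlace K) (t : K) :
    ‖algebraMap K v.Completion t‖ = NFPlace.abs (.inl v) t :=
  NumberField.InfinitePlace.Completion.norm_coe v (WithAbs.toAbs v.1 t)

lemma norm_adicCompletion (p : HeightOneSpectrum (𝓞 K)) (t : K) :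
    ‖algebraMap K (p.adicCompletion K) t‖ = NFPlace.abs (.inr p) t :=
  NumberField.FinitePlace.norm_embedding p t

end NFPlace

/-! ### The uniform structure of `*K` compared with the metrics of the completions. -/

namespace NonstandardExtension

variable {E : NonstandardExtension.{u, w}} {K : Type u} [Field K] [NumberField K]

section topology

lemma tendsto_nhds_uniformSpaceV {Z : Type*} {l : Filter Z} {g : Z → E.Ext K} {x : E.Ext K} :
    Tendsto g l (@nhds _ (E.uniformSpaceV K).toTopologicalSpace x) ↔
      ∀ (v : NFPlace K) (ε : ℝ), 0 < ε → ∀ᶠ z in l, E.absV v (x - g z) < E.real ε := by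
  rw [@nhds_eq_comap_uniformity _ (E.uniformSpaceV K) x, tendsto_comap_iff]
  change Tendsto _ _ (⨅ (v : NFPlace K) (ε : {ε : ℝ // 0 < ε}),
        Filter.principal {p : E.Ext K × E.Ext K | E.absV v (p.1 - p.2) < E.real ε.1}) ↔ _
  simp only [tendsto_iInf, tendsto_principal, Subtype.forall]
  rfl

lemma eventually_absV_sub_lt (x : E.Ext K) (v : NFPlace K) {ε : ℝ} (hε : 0 < ε) :
    ∀ᶠ y in @nhds _ (E.uniformSpaceV K).toTopologicalSpace x, E.absV v (x - y) < E.real ε :=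
  tendsto_nhds_uniformSpaceV.1 tendsto_id v ε hε

variable {Y F : Type*} [NormedField F] {f : K →+* F} {v : NFPlace K} {i : Y → E.Ext K} {a : Y → F}

lemma continuous_of_tendsto_type (hf : ∀ t, ‖f t‖ = NFPlace.abs v t)
    (ha : ∀ y, Tendsto f (type (i y)) (𝓝 (a y))) :
    @Continuous _ _ ((E.uniformSpaceV K).toTopologicalSpace.induced i) _ a := by
  let T := (E.uniformSpaceV K).toTopologicalSpace
  let T' := T.induced i
  refine continuous_iff_continuousAt.2 fun x => Metric.tendsto_nhds.2 fun ε hε => ?_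
  rw [nhds_induced]
  refine (tendsto_comap.eventually (eventually_absV_sub_lt (i x) v (half_pos hε))).mono
    fun y hy => ?_
  rw [absV, realMap_lt_iff] at hy
  have h1 := (tendsto_type_sub f (ha x) (ha y)).norm
  -- A strict bound only survives the limit as `≤`; starting from `ε / 2` restores strictness.
  have h2 : ‖a x - a y‖ ≤ ε / 2 := le_of_tendsto h1 (hy.mono fun t ht => (hf t).trans_le ht.le)
  rw [dist_comm, dist_eq_norm]
  linarith

lemma eventually_absV_sub_lt_of_continuous [TopologicalSpace Y]
    (hf : ∀ t, ‖f t‖ = NFPlace.abs v t)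
    (ha : ∀ y, Tendsto f (type (i y)) (𝓝 (a y))) (hc : Continuous a) (x : Y) {ε : ℝ}
    (hε : 0 < ε) : ∀ᶠ y in 𝓝 x, E.absV v (i x - i y) < E.real ε := by
  refine (Metric.tendsto_nhds.1 hc.continuousAt ε hε).mono fun y hy => ?_
  rw [absV, realMap_lt_iff]
  rw [dist_comm, dist_eq_norm] at hy
  refine ((tendsto_type_sub f (ha x) (ha y)).norm.eventually_lt_const hy).mono fun t ht => ?_
  rwa [← hf]

end topology

/-! ### Standard parts as adeles. -/

section standardPart

lemma isStandardPart_iff {x : E.Ext K} {α : NumberField.AdeleRing (𝓞 K) K} :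
    E.IsStandardPart x α ↔
      (∀ v : NumberField.InfinitePlace K,
        Tendsto (algebraMap K v.Completion) (type x) (𝓝 (α.1 v))) ∧
      ∀ p : HeightOneSpectrum (𝓞 K),
        Tendsto (algebraMap K (p.adicCompletion K)) (type x) (𝓝 (α.2 p)) :=
  and_congr (forall_congr' fun _ => isInf_realMap_norm_sub_iff)
    (forall_congr' fun _ => isInf_realMap_norm_sub_iff)

lemma IsStandardPart.unique {x : E.Ext K} {α β : NumberField.AdeleRing (𝓞 K) K}
    (hα : E.IsStandardPart x α) (hβ : E.IsStandardPart x β) : α = β := by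
  rw [isStandardPart_iff] at hα hβ
  refine Prod.ext (funext fun v => ?_) (FiniteAdeleRing.ext _ fun p => ?_)
  · exact tendsto_nhds_unique (hα.1 v) (hβ.1 v)
  · exact tendsto_nhds_unique (hα.2 p) (hβ.2 p)

lemma IsStandardPart.mul {x y : E.Ext K} {α β : NumberField.AdeleRing (𝓞 K) K}
    (hα : E.IsStandardPart x α) (hβ : E.IsStandardPart y β) :
    E.IsStandardPart (x * y) (α * β) := by
  rw [isStandardPart_iff] at hα hβ ⊢
  exact ⟨fun v => tendsto_type_mul _ (hα.1 v) (hβ.1 v),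
    fun p => tendsto_type_mul _ (hα.2 p) (hβ.2 p)⟩

lemma isStandardPart_one : E.IsStandardPart (1 : E.Ext K) 1 :=
  isStandardPart_iff.2 ⟨fun _ => tendsto_type_one _, fun _ => tendsto_type_one _⟩

lemma isStandardPart_one_iff {x : E.Ext K} : E.IsStandardPart x 1 ↔ x - 1 ∈ E.infV K := by
  have key : ∀ {F : Type u} [NormedField F] (f : K →+* F) (v : NFPlace K)
      (_ : ∀ t, ‖f t‖ = NFPlace.abs v t), Tendsto f (type x) (𝓝 1) ↔ E.IsInf (E.absV v (x - 1)) := by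
    intro F _ f v hf
    have h1 : E.IsInf (E.absV v (x - 1)) ↔ Tendsto f (type (x - 1)) (𝓝 0) := by
      rw [← isInf_realMap_norm_sub_iff]
      simp only [sub_zero, hf]
      rfl
    rw [h1]
    constructor
    · intro h
      simpa using tendsto_type_sub f h (tendsto_type_one f)
    · intro h
      simpa using tendsto_type_add f h (tendsto_type_one f)
  rw [isStandardPart_iff]
  refine Iff.trans (and_congr (forall_congr' fun v => ?_) (forall_congr' fun p => ?_))
    Sum.forall.symm
  · exact key (algebraMap K v.Completion) (.inl v) (NFPlace.norm_completion v)
  · exact key (algebraMap K (p.adicCompletion K)) (.inr p) (NFPlace.norm_adicCompletion p)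

lemma mem_finVS {S : Finset (NFPlace K)} {x : E.Ext K} :
    x ∈ E.finVS K S ↔ (∀ v, ∃ r : ℝ, ∀ᶠ t in (type x : Filter K), NFPlace.abs v t ≤ r) ∧
      ∀ p : HeightOneSpectrum (𝓞 K), Sum.inr p ∉ S →
        ∀ᶠ t in (type x : Filter K), NFPlace.abs (.inr p) t ≤ 1 := by
  simp only [← realMap_le_iff]
  rfl

lemma exists_isStandardPart {S : Finset (NFPlace K)} {x : E.Ext K} (hx : x ∈ E.finVS K S) :
    ∃ α : NumberField.AdeleRing (𝓞 K) K, E.IsStandardPart x α := by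
  rw [mem_finVS] at hx
  have h1 : ∀ v : NumberField.InfinitePlace K, ∃ a : v.Completion,
      Tendsto (algebraMap K v.Completion) (type x) (𝓝 a) := by
    intro v
    obtain ⟨r, hr⟩ := hx.1 (.inl v)
    simp only [← NFPlace.norm_completion] at hr
    obtain ⟨a, -, ha⟩ := exists_tendsto_type hr
    exact ⟨a, ha⟩
  have h2 : ∀ p : HeightOneSpectrum (𝓞 K), ∃ a : p.adicCompletion K,
      (Sum.inr p ∉ S → ‖a‖ ≤ 1) ∧
        Tendsto (algebraMap K (p.adicCompletion K)) (type x) (𝓝 a) := by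
    intro p
    by_cases hp : Sum.inr p ∈ S
    · obtain ⟨r, hr⟩ := hx.1 (.inr p)
      simp only [← NFPlace.norm_adicCompletion] at hr
      obtain ⟨a, -, ha⟩ := exists_tendsto_type hr
      exact ⟨a, fun h => absurd hp h, ha⟩
    · have hr := hx.2 p hp
      simp only [← NFPlace.norm_adicCompletion] at hr
      obtain ⟨a, ha', ha⟩ := exists_tendsto_type hr
      exact ⟨a, fun _ => ha', ha⟩
  choose a ha using h1
  choose b hb' hb using h2
  -- Outside the finite set `S` the bound `1` passes to the limit, which is the restricted product
  -- condition.
  have hfin : ∀ᶠ p in cofinite, b p ∈ p.adicCompletionIntegers K := by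
    refine (S.finite_toSet.preimage Sum.inr_injective.injOn).subset fun p hp => ?_
    by_contra h
    exact hp (NumberField.norm_adicCompletion_le_one_iff.1 (hb' p h))
  exact ⟨(a, ⟨b, hfin⟩), isStandardPart_iff.2 ⟨ha, hb⟩⟩

/-- Since the local integer ring is open, being infinitely close to an integral element forces the
exact bound `|x|_p ≤ 1`. -/
lemma IsStandardPart.eventually_abs_le_one {x : E.Ext K} {α : NumberField.AdeleRing (𝓞 K) K}
    (h : E.IsStandardPart x α) {p : HeightOneSpectrum (𝓞 K)}
    (hp : α.2 p ∈ p.adicCompletionIntegers K) :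
    ∀ᶠ t in (type x : Filter K), NFPlace.abs (.inr p) t ≤ 1 := by
  have ho : IsOpen (p.adicCompletionIntegers K : Set (p.adicCompletion K)) :=
    Valued.isOpen_valuationSubring _
  refine (((isStandardPart_iff.1 h).2 p).eventually (ho.mem_nhds hp)).mono fun t ht => ?_
  rw [← NFPlace.norm_adicCompletion]
  exact NumberField.norm_adicCompletion_le_one_iff.2 ht

lemma IsStandardPart.norm_le_one {S : Finset (NFPlace K)} {x : E.Ext K} (hx : x ∈ E.finVS K S)
    {α : NumberField.AdeleRing (𝓞 K) K} (h : E.IsStandardPart x α)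
    {p : HeightOneSpectrum (𝓞 K)} (hp : Sum.inr p ∉ S) :
    α.2 p ∈ p.adicCompletionIntegers K := by
  refine NumberField.norm_adicCompletion_le_one_iff.1 ?_
  refine le_of_tendsto ((isStandardPart_iff.1 h).2 p).norm (((mem_finVS.1 hx).2 p hp).mono
    fun t ht => (NFPlace.norm_adicCompletion p t).trans_le ht)

lemma IsStandardPart.mem_finVS {S : Finset (NFPlace K)} {x : E.Ext K}
    {α : NumberField.AdeleRing (𝓞 K) K} (h : E.IsStandardPart x α)
    (hS : ∀ p : HeightOneSpectrum (𝓞 K), Sum.inr p ∉ S → α.2 p ∈ p.adicCompletionIntegers K) :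
    x ∈ E.finVS K S := by
  refine NonstandardExtension.mem_finVS.2 ⟨fun v => ?_, fun p hp => h.eventually_abs_le_one (hS p hp)⟩
  rw [isStandardPart_iff] at h
  rcases v with v | p
  -- The norms may approach their limit from above, hence the margin `1`.
  · refine ⟨‖α.1 v‖ + 1, ?_⟩
    refine ((h.1 v).norm.eventually_lt_const (lt_add_one _)).mono fun t ht => ?_
    rw [← NFPlace.norm_completion]
    exact ht.le
  · refine ⟨‖α.2 p‖ + 1, ?_⟩
    refine ((h.2 p).norm.eventually_lt_const (lt_add_one _)).mono fun t ht => ?_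
    rw [← NFPlace.norm_adicCompletion]
    exact ht.le

end standardPart

/-! ### The open cover of the ideles by the sets of `S`-integral units. -/

section ideles

/-- The ideles which are units at all finite places outside `S`. -/
def idelesS (S : Finset (NFPlace K)) : Set (NumberField.AdeleRing (𝓞 K) K)ˣ :=
  {a | (∀ p : HeightOneSpectrum (𝓞 K), Sum.inr p ∉ S → a.1.2 p ∈ p.adicCompletionIntegers K) ∧
    ∀ p : HeightOneSpectrum (𝓞 K), Sum.inr p ∉ S → a⁻¹.1.2 p ∈ p.adicCompletionIntegers K}

lemma isOpen_idelesS (S : Finset (NFPlace K)) : IsOpen (idelesS S) := by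
  have h : IsOpen {b : FiniteAdeleRing (𝓞 K) K |
      ∀ p : HeightOneSpectrum (𝓞 K), Sum.inr p ∉ S → b p ∈ p.adicCompletionIntegers K} :=
    RestrictedProduct.isOpen_forall_imp_mem (R := fun p : HeightOneSpectrum (𝓞 K) =>
      p.adicCompletion K) (A := fun p => (p.adicCompletionIntegers K : Set (p.adicCompletion K)))
      fun _ => Valued.isOpen_valuationSubring _
  have hs : Continuous fun b : NumberField.AdeleRing (𝓞 K) K => b.2 := continuous_snd
  exact (h.preimage (hs.comp Units.continuous_val)).inter
    (h.preimage (hs.comp (Units.continuous_val.comp continuous_inv)))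

lemma exists_mem_idelesS (a : (NumberField.AdeleRing (𝓞 K) K)ˣ) :
    ∃ S : Finset (NFPlace K), a ∈ idelesS S := by
  classical
  have h : ∀ b : NumberField.AdeleRing (𝓞 K) K, ∃ S : Finset (NFPlace K),
      ∀ p : HeightOneSpectrum (𝓞 K), Sum.inr p ∉ S → b.2 p ∈ p.adicCompletionIntegers K := by
    intro b
    have hb : {p : HeightOneSpectrum (𝓞 K) | ¬ b.2 p ∈ p.adicCompletionIntegers K}.Finite := b.2.2
    refine ⟨hb.toFinset.image Sum.inr, fun p hp => ?_⟩
    by_contra hp'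
    exact hp (Finset.mem_image_of_mem _ (hb.mem_toFinset.2 hp'))
  obtain ⟨S, hS⟩ := h a.1
  obtain ⟨T, hT⟩ := h a⁻¹.1
  exact ⟨S ∪ T, fun p hp => hS p fun h => hp (Finset.mem_union_left _ h),
    fun p hp => hT p fun h => hp (Finset.mem_union_right _ h)⟩

end ideles

end NonstandardExtension

/-! ### The standard part homomorphism, its kernel and its surjectivity. -/

namespace NonstandardExtension

variable (E : NonstandardExtension.{u, w}) (K : Type u) [Field K] [NumberField K]

variable {E K} in
lemma UnitsV.exists_mem_unitsVS (x : E.UnitsV K) : ∃ S, x.1 ∈ E.unitsVS K S :=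
  Set.mem_iUnion.1 x.2

variable {E K} in
lemma UnitsV.exists_isStandardPart (x : E.UnitsV K) :
    ∃ α : NumberField.AdeleRing (𝓞 K) K, E.IsStandardPart x.val α := by
  obtain ⟨S, hS⟩ := x.exists_mem_unitsVS
  exact NonstandardExtension.exists_isStandardPart hS.1

/-- The canonical map `U_V(*K) → 𝔸_K`, with values in the adele ring. -/
noncomputable def standardPartAdele : E.UnitsV K →* NumberField.AdeleRing (𝓞 K) K where
  toFun x := x.exists_isStandardPart.choose
  map_one' := (UnitsV.exists_isStandardPart (1 : E.UnitsV K)).choose_spec.unique isStandardPart_one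
  map_mul' x y := (UnitsV.exists_isStandardPart (x * y)).choose_spec.unique
    (x.exists_isStandardPart.choose_spec.mul y.exists_isStandardPart.choose_spec)

/-- The canonical map from `U_V(*K)` to the ideles. -/
noncomputable def standardPart : E.UnitsV K →* (NumberField.AdeleRing (𝓞 K) K)ˣ :=
  (E.standardPartAdele K).toHomUnits

variable {E K}

lemma isStandardPart_standardPart (x : E.UnitsV K) :
    E.IsStandardPart x.val (E.standardPart K x : NumberField.AdeleRing (𝓞 K) K) :=
  x.exists_isStandardPart.choose_spec

lemma isStandardPart_standardPart_inv (x : E.UnitsV K) :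
    E.IsStandardPart x⁻¹.val ((E.standardPart K x)⁻¹ : (NumberField.AdeleRing (𝓞 K) K)ˣ).1 := by
  rw [← map_inv]
  exact isStandardPart_standardPart _

/-- Because of this, `U_{V,S}` is the full preimage of an open set of ideles, so the final topology
can be tested on one `U_{V,S}` at a time. -/
lemma standardPart_mem_idelesS_iff {S : Finset (NFPlace K)} {x : E.UnitsV K} :
    E.standardPart K x ∈ idelesS S ↔ x.1 ∈ E.unitsVS K S := by
  constructor
  · rintro ⟨h1, h2⟩
    exact ⟨(isStandardPart_standardPart x).mem_finVS h1,
      (isStandardPart_standardPart_inv x).mem_finVS h2⟩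
  · rintro ⟨h1, h2⟩
    exact ⟨fun p hp => (isStandardPart_standardPart x).norm_le_one h1 hp,
      fun p hp => (isStandardPart_standardPart_inv x).norm_le_one (x := x⁻¹.val) h2 hp⟩

lemma exists_standardPart_eq {x : E.Ext K} {a : (NumberField.AdeleRing (𝓞 K) K)ˣ}
    (h : E.IsStandardPart x a.1) : ∃ u : E.UnitsV K, u.val = x ∧ E.standardPart K u = a := by
  have hst := isStandardPart_iff.1 h
  have h1 : ∀ v : NumberField.InfinitePlace K, a.1.1 v * a⁻¹.1.1 v = 1 := fun v =>
    congrFun (congrArg Prod.fst a.mul_inv) v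
  have h2 : ∀ p : HeightOneSpectrum (𝓞 K), a.1.2 p * a⁻¹.1.2 p = 1 := fun p =>
    DFunLike.congr_fun (congrArg Prod.snd a.mul_inv) p
  -- One place with nonzero standard part suffices to make `x` invertible in `*K`; the inverse is
  -- the extension of `t ↦ t⁻¹`.
  have hx : ∀ᶠ t in (type x : Filter K), t ≠ 0 := by
    obtain ⟨v⟩ : Nonempty (NumberField.InfinitePlace K) := inferInstance
    refine ((hst.1 v).eventually_ne (left_ne_zero_of_mul_eq_one (h1 v))).mono fun t ht h0 => ht ?_
    rw [h0, map_zero]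
  have hinv : E.IsStandardPart (E.map (fun t : K => t⁻¹) x) a⁻¹.1 := by
    refine isStandardPart_iff.2 ⟨fun v => ?_, fun p => ?_⟩
    · rw [tendsto_type_map, eq_inv_of_mul_eq_one_right (h1 v)]
      simpa only [map_inv₀] using (hst.1 v).inv₀ (left_ne_zero_of_mul_eq_one (h1 v))
    · rw [tendsto_type_map, eq_inv_of_mul_eq_one_right (h2 p)]
      simpa only [map_inv₀] using (hst.2 p).inv₀ (left_ne_zero_of_mul_eq_one (h2 p))
  have hm := mul_map_inv_cancel hx
  obtain ⟨S, hS⟩ := exists_mem_idelesS a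
  let y : (E.Ext K)ˣ := ⟨x, E.map (fun t : K => t⁻¹) x, hm, by rw [mul_comm, hm]⟩
  have hy : y ∈ E.unitsVS K S := ⟨h.mem_finVS hS.1, hinv.mem_finVS hS.2⟩
  refine ⟨⟨y, Set.mem_iUnion.2 ⟨S, hy⟩⟩, rfl, Units.ext ?_⟩
  exact (isStandardPart_standardPart _).unique h

lemma image_ker_standardPart :
    UnitsV.val '' ((E.standardPart K).ker : Set (E.UnitsV K)) =
      {x : E.Ext K | ∃ y ∈ E.infV K, x = 1 + y} := by
  have key : ∀ x : E.Ext K, (∃ y ∈ E.infV K, x = 1 + y) ↔ E.IsStandardPart x 1 := by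
    intro x
    rw [isStandardPart_one_iff]
    constructor
    · rintro ⟨y, hy, rfl⟩
      rwa [add_sub_cancel_left]
    · intro h
      exact ⟨_, h, (add_sub_cancel _ _).symm⟩
  ext x
  rw [Set.mem_ofPred_eq, key]
  constructor
  · rintro ⟨u, hu, rfl⟩
    have h := isStandardPart_standardPart u
    rw [MonoidHom.mem_ker.1 hu] at h
    exact h
  · intro h
    obtain ⟨u, rfl, hu⟩ := exists_standardPart_eq (a := 1) h
    exact ⟨u, hu, rfl⟩

lemma CountablySaturated.exists_isStandardPart (hE : E.CountablySaturated)
    (α : NumberField.AdeleRing (𝓞 K) K) : ∃ x : E.Ext K, E.IsStandardPart x α := by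
  have hc := NumberField.countable_nfPlace K
  -- Countably many conditions: being within `1 / (n + 1)` of `α_v`, for all `v` and `n`. No
  -- integrality is imposed, since closeness to an adele implies it.
  let A : NFPlace K × ℕ → Set K := fun i => Sum.elim
    (fun v : NumberField.InfinitePlace K =>
      {t | dist (algebraMap K v.Completion t) (α.1 v) < 1 / (i.2 + 1 : ℝ)})
    (fun p : HeightOneSpectrum (𝓞 K) =>
      {t | dist (algebraMap K (p.adicCompletion K) t) (α.2 p) < 1 / (i.2 + 1 : ℝ)}) i.1
  obtain ⟨x, hx⟩ := hE.exists_mem A fun F => by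
    classical
    -- `N` bounds the indices in `F`, so `ε` meets every tolerance. Half of it goes to replacing
    -- each `α_v` by an element of `K`, half to weak approximation.
    obtain ⟨N, hN⟩ := (F.image Prod.snd).exists_le
    set ε : ℝ := 1 / (N + 1 : ℝ) with hεd
    have hε : 0 < ε := Nat.one_div_pos_of_nat
    have hle : ∀ i ∈ F, ε ≤ 1 / (i.2 + 1 : ℝ) := fun i hi =>
      Nat.one_div_le_one_div (hN _ (Finset.mem_image_of_mem _ hi))
    have h1 : ∀ v : NumberField.InfinitePlace K, ∃ b : K,
        dist (α.1 v) (algebraMap K v.Completion b) < ε / 2 := fun v => by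
      have hd : DenseRange (algebraMap K v.Completion) :=
        (NumberField.InfinitePlace.Completion.denseRange_coe v).comp
          (WithAbs.equiv v.1).symm.surjective.denseRange
          (NumberField.InfinitePlace.Completion.continuous_coe v)
      exact hd.exists_dist_lt _ (half_pos hε)
    have h2 : ∀ p : HeightOneSpectrum (𝓞 K), ∃ b : K,
        dist (α.2 p) (algebraMap K (p.adicCompletion K) b) < ε / 2 := fun p =>
      (HeightOneSpectrum.denseRange_algebraMap K p).exists_dist_lt _ (half_pos hε)
    choose b hb using h1
    choose c hc using h2
    obtain ⟨t, ht⟩ := NFPlace.exists_abs_sub_lt (F.image Prod.fst) (Sum.elim b c) (half_pos hε)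
    refine ⟨t, fun i hi => ?_⟩
    have ht' := ht i.1 (Finset.mem_image_of_mem _ hi)
    have hi' := hle i hi
    obtain ⟨v | p, n⟩ := i
    · change dist _ _ < _
      rw [← NFPlace.norm_completion, map_sub, ← dist_eq_norm] at ht'
      have := dist_triangle_right (algebraMap K v.Completion t) (α.1 v)
        (algebraMap K v.Completion (b v))
      linarith [hb v, show dist (algebraMap K v.Completion t) (algebraMap K v.Completion (b v)) <
        ε / 2 from ht']
    · change dist _ _ < _
      rw [← NFPlace.norm_adicCompletion, map_sub, ← dist_eq_norm] at ht'
      have := dist_triangle_right (algebraMap K (p.adicCompletion K) t) (α.2 p)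
        (algebraMap K (p.adicCompletion K) (c p))
      linarith [hc p, show dist (algebraMap K (p.adicCompletion K) t)
        (algebraMap K (p.adicCompletion K) (c p)) < ε / 2 from ht']
  refine ⟨x, isStandardPart_iff.2 ⟨fun v => ?_, fun p => ?_⟩⟩
  · refine Metric.tendsto_nhds.2 fun ε hε => ?_
    obtain ⟨n, hn⟩ := exists_nat_one_div_lt hε
    exact (eventually_type.2 (hx (.inl v, n))).mono fun t ht => lt_trans ht hn
  · refine Metric.tendsto_nhds.2 fun ε hε => ?_
    obtain ⟨n, hn⟩ := exists_nat_one_div_lt hε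
    exact (eventually_type.2 (hx (.inr p, n))).mono fun t ht => lt_trans ht hn

lemma CountablySaturated.surjective_standardPart (hE : E.CountablySaturated) :
    Function.Surjective (E.standardPart K) := fun a => by
  obtain ⟨x, hx⟩ := hE.exists_isStandardPart a.1
  obtain ⟨u, -, hu⟩ := exists_standardPart_eq hx
  exact ⟨u, hu⟩

end NonstandardExtension

/-! ### The topology of `U_V(*K)` is induced from the ideles. -/

namespace NonstandardExtension

variable {E : NonstandardExtension.{u, w}} {K : Type u} [Field K] [NumberField K]

/-- A map to the adeles which is continuous at each place and integral at all finite places outside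
the finite set `S` is continuous. -/
lemma continuous_adele_of_integral {Y : Type*} {S : Finset (NFPlace K)} [TopologicalSpace Y]
    (a : Y → NumberField.AdeleRing (𝓞 K) K)
    (h1 : ∀ v : NumberField.InfinitePlace K, Continuous fun y => (a y).1 v)
    (h2 : ∀ p : HeightOneSpectrum (𝓞 K), Continuous fun y => (a y).2 p)
    (hS : ∀ (p : HeightOneSpectrum (𝓞 K)) (y : Y), Sum.inr p ∉ S →
      (a y).2 p ∈ p.adicCompletionIntegers K) : Continuous a := by
  have hT : cofinite ≤ 𝓟 {p : HeightOneSpectrum (𝓞 K) | Sum.inr p ∉ S} := by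
    rw [le_principal_iff, mem_cofinite]
    refine (S.finite_toSet.preimage Sum.inr_injective.injOn).subset fun p hp => ?_
    exact not_not.1 hp
  have h1' : Continuous fun y => (a y).1 := continuous_pi h1
  have h2' : Continuous fun y => (a y).2 := by
    -- Integrality outside a fixed `S` factors the map through a restricted product over a principal
    -- filter, whose topology is that of pointwise convergence.
    let g : Y → RestrictedProduct (fun p : HeightOneSpectrum (𝓞 K) => p.adicCompletion K)
        (fun p => (p.adicCompletionIntegers K : Set (p.adicCompletion K)))
        (𝓟 {p : HeightOneSpectrum (𝓞 K) | Sum.inr p ∉ S}) :=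
      fun y => ⟨fun p => (a y).2 p, eventually_principal.2 fun p hp => hS p y hp⟩
    have hg : Continuous g := RestrictedProduct.continuous_rng_of_principal_iff_forall.2 h2
    exact (RestrictedProduct.continuous_inclusion hT).comp hg
  exact h1'.prodMk h2'

lemma continuous_standardPart : Continuous (E.standardPart K) := by
  refine continuous_iSup_dom.2 fun S => continuous_coinduced_dom.2 ?_
  let : TopologicalSpace (E.unitsVS K S) := E.unitsVSTopology K S
  have hst := fun y : E.unitsVS K S =>
    isStandardPart_iff.1 (isStandardPart_standardPart (E.unitsVSIncl K S y))
  have hmem : ∀ y : E.unitsVS K S, E.standardPart K (E.unitsVSIncl K S y) ∈ idelesS S :=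
    fun y => standardPart_mem_idelesS_iff.2 y.2
  have h1 : ∀ v : NumberField.InfinitePlace K,
      Continuous fun y => (E.standardPart K (E.unitsVSIncl K S y)).1.1 v := fun v =>
    continuous_of_tendsto_type (NFPlace.norm_completion v) fun y => (hst y).1 v
  have h2 : ∀ p : HeightOneSpectrum (𝓞 K),
      Continuous fun y => (E.standardPart K (E.unitsVSIncl K S y)).1.2 p := fun p =>
    continuous_of_tendsto_type (NFPlace.norm_adicCompletion p) fun y => (hst y).2 p
  have e1 : ∀ (a : (NumberField.AdeleRing (𝓞 K) K)ˣ) (v : NumberField.InfinitePlace K),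
      a.1.1 v * a⁻¹.1.1 v = 1 := fun a v => congrFun (congrArg Prod.fst a.mul_inv) v
  have e2 : ∀ (a : (NumberField.AdeleRing (𝓞 K) K)ˣ) (p : HeightOneSpectrum (𝓞 K)),
      a.1.2 p * a⁻¹.1.2 p = 1 := fun a p => DFunLike.congr_fun (congrArg Prod.snd a.mul_inv) p
  refine Units.continuous_iff.2 ⟨?_, ?_⟩
  · exact continuous_adele_of_integral (S := S) _ h1 h2 fun p y hp => (hmem y).1 p hp
  · refine continuous_adele_of_integral (S := S) _ (fun v => ?_) (fun p => ?_)
      fun p y hp => (hmem y).2 p hp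
    -- Continuity of the inverse coordinate comes from inversion in the field `K_v`, so nothing is
    -- needed about inversion in `*K`.
    · have := (h1 v).inv₀ fun y => left_ne_zero_of_mul_eq_one (e1 _ v)
      refine this.congr fun y => ?_
      exact (eq_inv_of_mul_eq_one_right (e1 _ v)).symm
    · have := (h2 p).inv₀ fun y => left_ne_zero_of_mul_eq_one (e2 _ p)
      refine this.congr fun y => ?_
      exact (eq_inv_of_mul_eq_one_right (e2 _ p)).symm

/-- For the topology induced by the ideles, the inclusion `U_V(*K) → *K` is continuous. -/
lemma continuous_val_induced_standardPart :
    @Continuous _ _ (TopologicalSpace.induced (E.standardPart K) inferInstance)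
      (E.uniformSpaceV K).toTopologicalSpace (UnitsV.val : E.UnitsV K → E.Ext K) := by
  let T : TopologicalSpace (E.UnitsV K) :=
    TopologicalSpace.induced (E.standardPart K) inferInstance
  let := (E.uniformSpaceV K).toTopologicalSpace
  have hc : Continuous (E.standardPart K) := continuous_induced_dom
  have hst := fun y : E.UnitsV K => isStandardPart_iff.1 (isStandardPart_standardPart y)
  have hfst : Continuous fun b : NumberField.AdeleRing (𝓞 K) K => b.1 := continuous_fst
  have hsnd : Continuous fun b : NumberField.AdeleRing (𝓞 K) K => b.2 := continuous_snd
  refine continuous_iff_continuousAt.2 fun x => tendsto_nhds_uniformSpaceV.2 fun v ε hε => ?_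
  rcases v with v | p
  · refine eventually_absV_sub_lt_of_continuous (NFPlace.norm_completion v)
      (fun y => (hst y).1 v) ?_ x hε
    exact (continuous_apply v).comp (hfst.comp (Units.continuous_val.comp hc))
  · refine eventually_absV_sub_lt_of_continuous (NFPlace.norm_adicCompletion p)
      (fun y => (hst y).2 p) ?_ x hε
    have he : Continuous fun b : FiniteAdeleRing (𝓞 K) K => b p :=
      RestrictedProduct.continuous_eval p
    exact he.comp (hsnd.comp (Units.continuous_val.comp hc))

/-- The topology of `U_V(*K)` is induced by the topology of the ideles. -/
lemma isInducing_standardPart : IsInducing (E.standardPart K) := by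
  refine ⟨le_antisymm continuous_standardPart.le_induced fun W hW => ?_⟩
  let T : TopologicalSpace (E.UnitsV K) :=
    TopologicalSpace.induced (E.standardPart K) inferInstance
  have hc : Continuous (E.standardPart K) := continuous_induced_dom
  refine isOpen_iff_mem_nhds.2 fun x hx => ?_
  obtain ⟨S, hS⟩ := exists_mem_idelesS (E.standardPart K x)
  -- On `U_{V,S}`, `W` is cut out by an open `O` of `*K`. As `U_{V,S}` is open for the induced
  -- topology and the inclusion in `*K` is continuous for it, `W` is a neighbourhood of `x`.
  have hWS := isOpen_coinduced.1 (isOpen_iSup_iff.1 hW S)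
  obtain ⟨O, hO, hOW⟩ := (@isOpen_induced_iff _ _ (E.uniformSpaceV K).toTopologicalSpace _ _).1 hWS
  have hO' : IsOpen ((UnitsV.val : E.UnitsV K → E.Ext K) ⁻¹' O) :=
    @IsOpen.preimage _ _ _ (E.uniformSpaceV K).toTopologicalSpace _
      continuous_val_induced_standardPart _ hO
  have hmem : ∀ y (hy : y ∈ E.standardPart K ⁻¹' idelesS S), y.val ∈ O ↔ y ∈ W := fun y hy =>
    Set.ext_iff.1 hOW ⟨y.1, standardPart_mem_idelesS_iff.1 hy⟩
  refine mem_of_superset ((hO'.inter ((isOpen_idelesS S).preimage hc)).mem_nhds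
    ⟨(hmem x hS).2 hx, hS⟩) ?_
  rintro y ⟨hy1, hy2⟩
  exact (hmem y hy2).1 hy1

end NonstandardExtension

/-! ### Formal consequences of a surjective inducing map. -/

/-- The preimage of a locally compact space under a surjective inducing map is locally compact. -/
lemma Topology.IsInducing.locallyCompactSpace_of_surjective {X Y : Type*} [TopologicalSpace X]
    [TopologicalSpace Y] [LocallyCompactSpace Y] {f : X → Y} (hf : IsInducing f)
    (hs : Function.Surjective f) : LocallyCompactSpace X where
  local_compact_nhds x n hn := by
    rw [hf.nhds_eq_comap] at hn
    obtain ⟨m, hm, hmn⟩ := hn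
    obtain ⟨k, hk, hkm, hkc⟩ := local_compact_nhds hm
    refine ⟨f ⁻¹' k, ?_, (Set.preimage_mono hkm).trans hmn, ?_⟩
    · rw [hf.nhds_eq_comap]
      exact preimage_mem_comap hk
    · exact (hf.isCompact_preimage_iff (by simp [hs.range_eq])).2 hkc

/-- A surjective inducing homomorphism induces an isomorphism of topological groups. -/
lemma exists_continuousMulEquiv_quotient_ker {G H : Type*} [Group G] [Group H] [TopologicalSpace G]
    [TopologicalSpace H] {f : G →* H} (hf : IsInducing f) (hs : Function.Surjective f) :
    ∃ e : (G ⧸ f.ker) ≃ₜ* H, ∀ x : G, e (QuotientGroup.mk x) = f x := by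
  let e := QuotientGroup.quotientKerEquivOfSurjective f hs
  have he : Continuous e := continuous_quot_lift _ hf.continuous
  have he' : IsOpenMap e := by
    intro U hU
    -- The preimage of `U` in `G` is `f⁻¹ V` with `V` open; surjectivity makes the image of `U`
    -- equal to `V`.
    obtain ⟨V, hV, hVU⟩ := hf.isOpen_iff.1 (hU.preimage QuotientGroup.continuous_mk)
    have : e '' U = V := by
      ext y
      obtain ⟨x, rfl⟩ := hs y
      have hx := Set.ext_iff.1 hVU x
      constructor
      · rintro ⟨z, hz, hzx⟩
        have : z = QuotientGroup.mk x := e.injective hzx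
        rw [this] at hz
        exact hx.2 hz
      · intro h
        exact ⟨QuotientGroup.mk x, hx.1 h, rfl⟩
    rw [this]
    exact hV
  exact ⟨{ e with
    continuous_toFun := he
    continuous_invFun := (e.toEquiv.toHomeomorphOfContinuousOpen he he').continuous_symm },
    fun _ => rfl⟩

theorem mainTheorem9 (E : NonstandardExtension.{u, w}) (hE : E.CountablySaturated)
    (K : Type u) [Field K] [NumberField K] :
    IsTopologicalGroup (E.UnitsV K) ∧
    LocallyCompactSpace (E.UnitsV K) ∧
    ∃ φ : E.UnitsV K →* (NumberField.AdeleRing (𝓞 K) K)ˣ,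
      (∀ x : E.UnitsV K,
        E.IsStandardPart x.val (φ x : NumberField.AdeleRing (𝓞 K) K)) ∧
      Continuous φ ∧
      Function.Surjective φ ∧
      NonstandardExtension.UnitsV.val '' (φ.ker : Set (E.UnitsV K)) =
        {x : E.Ext K | ∃ y ∈ E.infV K, x = 1 + y} ∧
      (φ.ker : Set (E.UnitsV K)) = closure {1} ∧
      ∃ e : (E.UnitsV K ⧸ φ.ker) ≃ₜ* (NumberField.AdeleRing (𝓞 K) K)ˣ,
        ∀ x : E.UnitsV K, e (QuotientGroup.mk x) = φ x := by
  have hi : IsInducing (E.standardPart K) := NonstandardExtension.isInducing_standardPart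
  have hs : Function.Surjective (E.standardPart K) := hE.surjective_standardPart
  refine ⟨hi.topologicalGroup, hi.locallyCompactSpace_of_surjective hs, E.standardPart K,
    NonstandardExtension.isStandardPart_standardPart, hi.continuous, hs,
    NonstandardExtension.image_ker_standardPart, ?_,
    exists_continuousMulEquiv_quotient_ker hi hs⟩
  -- Closures are pulled back along an inducing map, and `{1}` is closed in the Hausdorff group of
  -- ideles.
  rw [hi.closure_eq_preimage_closure_image, Set.image_singleton, map_one, closure_singleton]
  rfl
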